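/- Let $(M,0)$ be the germ of a complex manifold, $D\ni 0$ a normal crossing divisor given in suitable coordinates by $z_1\cdots z_r=0$ ($1\le r\le m=\dim M$), and $\mathrm{Der}_M(\log D)$ the bundle of logarithmic vector fields, with frame $z_1\partial_1,\dots,z_r\partial_r,\partial_{r+1},\dots,\partial_m$. A Frobenius type structure with logarithmic pole along $D$ consists of a germ of a holomorphic vector bundle $K\to(M,0)$, a flat connection $\nabla^r$ on $K$ with logarithmic pole along $D$, a logarithmic Higgs field $\mathcal C$ (so $\mathcal C_X\in \mathrm{End}(K)$ is linear in $X\in \mathrm{Der}_M(\log D)$ and $[\mathcal C_X,\mathcal C_Y]=0$), holomorphic endomorphisms $\mathcal U,\mathcal V$ of $K$ with $[\mathcal U,\mathcal C_X]=0$ and $\nabla^r\mathcal V=0$, and a holomorphic symmetric nondegenerate $\nabla^r$-flat pairing $g$ on $K$, such that for all logarithmic vector fields $X,Y$ and sections $a,b$ of $K$ $$\nabla^r_X(\mathcal C_Y)-\nabla^r_Y(\mathcal C_X)-\mathcal C_{[X,Y]}=0,\qquad \nabla^r(\mathcal U)-[\mathcal C,\mathcal V]+\mathcal C=0,$$ $$g(\mathcal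 C_Xa,b)=g(a,\mathcal C_Xb),\qquad g(\mathcal Ua,b)=g(a,\mathcal Ub),\qquad g(\mathcal Va,b)=-g(a,\mathcal Vb).$$ A Frobenius manifold is a complex manifold of dimension $\ge 1$ whose tangent bundle carries a holomorphic commutative associative multiplication $\circ$ with global unit field $e$, a holomorphic symmetric nondegenerate pairing $\tilde g$ with Levi-Civita connection $\nabla^g$, and a holomorphic vector field $E$, such that $\tilde g(X\circ Y,Z)=\tilde g(X,Y\circ Z)$, the tensor $\nabla^g(\circ)$ is symmetric, $\nabla^g$ is flat, $\nabla^g e=0$, $\mathrm{Lie}_E(\circ)=\circ$ and $\mathrm{Lie}_E(\tilde g)=(2-d)\,\tilde g$ for some $d\in\mathbb C$. A Frobenius manifold with logarithmic pole along $D$ is such a structure on $M\setminus D$ for which $e$ and $E$ extend to holomorphic sections of $\mathrm{Der}_M(\log D)$ and $\circ$ and $\tilde g$ extend holomorphically to $\mathrm{Der}_M(\log D)$, with $\tilde g$ nondegenerate on $\mathrm{Der}_M(\log D)$. **Proposition.** Let $(K\to(M,0),D,\nabla^r,\mathcal C,\mathcal U,\mathcal V,g)$ be a Frobenius type structure with logarithmic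 pole along $D$, and let $\xi$ be a holomorphic section of $K$ that is $\nabla^r$-flat on $M\setminus D$, such that the map $\mathrm{Der}_M(\log D)_0\to K_0$, $X\mapsto-\mathcal C_X\xi|_0$, between the fibres at $0$ is an isomorphism and $\mathcal V\xi=\frac d2\xi$ with $d\in\mathbb C$. Then on some neighbourhood of $0$ the map $v\colon \mathrm{Der}_M(\log D)\to K$, $v(X)=-\mathcal C_X\xi$, is an isomorphism of bundles, and there is a Frobenius manifold $((M,0),D,\nabla^g,\circ,e,E,\tilde g)$ with logarithmic pole along $D$ and with $\mathrm{Lie}_E(\tilde g)=(2-d)\,\tilde g$ (the same $d$), whose Levi-Civita connection $\nabla^g$ has a logarithmic pole along $D$, and which corresponds to the given structure under $v$: for all logarithmic vector fields $X,Y$, $$v(e)=\xi,\quad v(E)=\mathcal U\xi,\quad v(\nabla^g_XY)=\nabla^r_X v(Y),\quad v(X\circ Y)=-\mathcal C_Xv(Y),\quad \tilde g(X,Y)=g(v(X),v(Y)),$$ $$v(E\circ X)=\mathcal U v(X),\qquad v\bigl(\nabla^g_XE-\tfrac{2-d}2X\bigr)=\mathcal V v(X).$$ -/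

import Mathlib

/-! Germs of complex manifolds with a normal crossing divisor through the base point are written in
coordinates `z` in which the base point is `0` and the divisor is `{z_1 ⋯ z_r = 0}`.
All data are given on an open neighbourhood of `0` (a representative of the germ); values
outside of that neighbourhood play no role. -/

/-- `ℂ^m`: the coordinate space, and the tangent space at each of its points. -/
abbrev CSpace (m : ℕ) : Type := Fin m → ℂ

/-- The normal crossing divisor `z_1 ⋯ z_r = 0` in `ℂ^m`. -/
def ncDivisor (m r : ℕ) : Set (CSpace m) := {z | ∃ i : Fin m, i.val < r ∧ z i = 0}

/-- The logarithmic vector fields along `z_1 ⋯ z_r = 0` form the free module on the frame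
`δ_i = z_i ∂_i` (for the first `r` indices), `δ_i = ∂_i` (for the others).
This frame identifies the fibre of `Der(log D)` at `z` with `ℂ^m`, and `logFrame r z a` is
the tangent vector `∑ a_i δ_i` at `z`. -/
noncomputable def logFrame {m : ℕ} (r : ℕ) (z : CSpace m) : CSpace m →L[ℂ] CSpace m :=
  ContinuousLinearMap.pi fun i : Fin m =>
    (if i.val < r then z i else 1) •
      (ContinuousLinearMap.proj i : CSpace m →L[ℂ] ℂ)

/-- The logarithmic vector field `∑ a_i δ_i` with coefficient functions `a`. -/
noncomputable def logField {m : ℕ} (r : ℕ) (a : CSpace m → CSpace m) : CSpace m → CSpace m :=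
  fun z => logFrame r z (a z)

/-- The derivative of a vector valued function along the logarithmic vector field `∑ a_i δ_i`. -/
noncomputable def logDirDeriv {m : ℕ} {V : Type*} [NormedAddCommGroup V] [NormedSpace ℂ V] (r : ℕ)
    (a : CSpace m → CSpace m) (f : CSpace m → V) : CSpace m → V :=
  fun z => fderiv ℂ f z (logField r a z)

/-- Coefficients, with respect to the frame `δ`, of the Lie bracket of the logarithmic vector
fields with coefficients `a` and `b` (the `δ_i` commute); see `logField_logBracket`. -/
noncomputable def logBracket {m : ℕ} (r : ℕ) (a b : CSpace m → CSpace m) : CSpace m → CSpace m :=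
  fun z => logDirDeriv r a b z - logDirDeriv r b a z

/-- `logBracket` computes the Lie bracket of vector fields. -/
theorem logField_logBracket {m : ℕ} (r : ℕ) (a b : CSpace m → CSpace m) (z : CSpace m)
    (ha : DifferentiableAt ℂ a z) (hb : DifferentiableAt ℂ b z) :
    logField r (logBracket r a b) z =
      VectorField.lieBracket ℂ (logField r a) (logField r b) z := by
  have key : ∀ (c : CSpace m → CSpace m), DifferentiableAt ℂ c z → ∀ (v : CSpace m) (i : Fin m),
      fderiv ℂ (logField r c) z v i =
        (if i.val < r then z i else 1) * fderiv ℂ c z v i +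
          (if i.val < r then v i * c z i else 0) := by
    intro c hc v i
    have hci : ∀ j : Fin m, HasFDerivAt (fun w => c w j)
        ((ContinuousLinearMap.proj j : CSpace m →L[ℂ] ℂ).comp (fderiv ℂ c z)) z := fun j =>
      (hasFDerivAt_pi'.1 hc.hasFDerivAt) j
    have hz : ∀ j : Fin m, HasFDerivAt (fun w : CSpace m => w j)
        (ContinuousLinearMap.proj j : CSpace m →L[ℂ] ℂ) z := fun j =>
      (ContinuousLinearMap.proj j : CSpace m →L[ℂ] ℂ).hasFDerivAt
    have hF : HasFDerivAt (logField r c)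
        (ContinuousLinearMap.pi fun j : Fin m =>
          (if j.val < r then z j else 1) •
            ((ContinuousLinearMap.proj j : CSpace m →L[ℂ] ℂ).comp (fderiv ℂ c z)) +
          (if j.val < r then c z j • (ContinuousLinearMap.proj j : CSpace m →L[ℂ] ℂ) else 0)) z := by
      rw [hasFDerivAt_pi']
      intro j
      by_cases hj : j.val < r
      · have h := (hz j).fun_mul (hci j)
        simpa [logField, logFrame, hj] using h
      · simpa [logField, logFrame, hj] using hci j
    rw [hF.fderiv]
    by_cases hi : i.val < r <;> simp [hi, mul_comm]
  funext i
  rw [VectorField.lieBracket]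
  simp only [Pi.sub_apply]
  rw [key b hb, key a ha]
  by_cases hi : i.val < r <;> simp [logField, logFrame, logBracket, logDirDeriv, hi]
  ring

/-- The covariant derivative `∇_X s` of a section `s` of the trivial bundle with fibre `V` along
the logarithmic vector field `X = ∑ a_i δ_i`, for the connection `∇ = d + A` with logarithmic
connection form `A`, that is `A = ∑_{i ≤ r} A_i dz_i / z_i + ∑_{i > r} A_i dz_i` and
`A z a = ∑ a_i A_i(z)`. -/
noncomputable def logNabla {m : ℕ} {V : Type*} [NormedAddCommGroup V] [NormedSpace ℂ V] (r : ℕ)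
    (A : CSpace m → CSpace m →L[ℂ] V →L[ℂ] V) (a : CSpace m → CSpace m) (s : CSpace m → V) :
    CSpace m → V :=
  fun z => logDirDeriv r a s z + A z (a z) (s z)

/-- Frobenius type structure with logarithmic poles along `D = {z_1 ⋯ z_r = 0}`, on the germ at
`0 ∈ D` of a holomorphic vector bundle `K` with (trivialised) fibre `F`. In the conditions,
`a`, `b` are the coefficients of arbitrary local logarithmic vector fields `X`, `Y`, and
`s`, `t` are arbitrary local holomorphic sections of `K`. -/
structure LogFrobeniusTypeStructure (m r : ℕ) (F : Type*) [NormedAddCommGroup F]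
    [NormedSpace ℂ F] [FiniteDimensional ℂ F] where
  /-- the neighbourhood of `0` on which the representatives live -/
  dom : Set (CSpace m)
  isOpen_dom : IsOpen dom
  zero_mem : (0 : CSpace m) ∈ dom
  /-- together with `r_le` this says `0 ∈ D` -/
  r_pos : 0 < r
  r_le : r ≤ m
  /-- logarithmic connection form of `∇^r` -/
  conn : CSpace m → CSpace m →L[ℂ] F →L[ℂ] F
  /-- Higgs field: `higgs z a s` is `C_X s` for `X = ∑ a_i δ_i` -/
  higgs : CSpace m → CSpace m →L[ℂ] F →L[ℂ] F
  /-- the endomorphism `𝒰` -/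
  opU : CSpace m → F →L[ℂ] F
  /-- the endomorphism `𝒱` -/
  opV : CSpace m → F →L[ℂ] F
  /-- the pairing `g` -/
  metric : CSpace m → F →L[ℂ] F →L[ℂ] ℂ
  conn_analytic : AnalyticOnNhd ℂ conn dom
  higgs_analytic : AnalyticOnNhd ℂ higgs dom
  opU_analytic : AnalyticOnNhd ℂ opU dom
  opV_analytic : AnalyticOnNhd ℂ opV dom
  metric_analytic : AnalyticOnNhd ℂ metric dom
  /-- `∇^r` is flat -/
  conn_flat : ∀ z ∈ dom, ∀ (a b : CSpace m → CSpace m) (s : CSpace m → F),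
    AnalyticAt ℂ a z → AnalyticAt ℂ b z → AnalyticAt ℂ s z →
      logNabla r conn a (logNabla r conn b s) z - logNabla r conn b (logNabla r conn a s) z
        - logNabla r conn (logBracket r a b) s z = 0
  /-- `C ∧ C = 0` -/
  higgs_comm : ∀ z ∈ dom, ∀ (x y : CSpace m) (s : F),
    higgs z x (higgs z y s) = higgs z y (higgs z x s)
  /-- `[𝒰, C_X] = 0` -/
  opU_higgs : ∀ z ∈ dom, ∀ (x : CSpace m) (s : F),
    opU z (higgs z x s) = higgs z x (opU z s)
  /-- `∇^r 𝒱 = 0` -/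
  opV_flat : ∀ z ∈ dom, ∀ (a : CSpace m → CSpace m) (s : CSpace m → F),
    AnalyticAt ℂ a z → AnalyticAt ℂ s z →
      logNabla r conn a (fun w => opV w (s w)) z = opV z (logNabla r conn a s z)
  metric_symm : ∀ z ∈ dom, ∀ s t : F, metric z s t = metric z t s
  metric_nondeg : ∀ z ∈ dom, ∀ s : F, (∀ t : F, metric z s t = 0) → s = 0
  /-- `∇^r g = 0` -/
  metric_flat : ∀ z ∈ dom, ∀ (a : CSpace m → CSpace m) (s t : CSpace m → F),
    AnalyticAt ℂ a z → AnalyticAt ℂ s z → AnalyticAt ℂ t z →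
      logDirDeriv r a (fun w => metric w (s w) (t w)) z =
        metric z (logNabla r conn a s z) (t z) + metric z (s z) (logNabla r conn a t z)
  /-- `∇^r_X (C_Y) - ∇^r_Y (C_X) - C_{[X,Y]} = 0` -/
  higgs_potential : ∀ z ∈ dom, ∀ (a b : CSpace m → CSpace m) (s : CSpace m → F),
    AnalyticAt ℂ a z → AnalyticAt ℂ b z → AnalyticAt ℂ s z →
      (logNabla r conn a (fun w => higgs w (b w) (s w)) z
          - higgs z (b z) (logNabla r conn a s z))
        - (logNabla r conn b (fun w => higgs w (a w) (s w)) z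
          - higgs z (a z) (logNabla r conn b s z))
        - higgs z (logBracket r a b z) (s z) = 0
  /-- `∇^r(𝒰) - [C, 𝒱] + C = 0` -/
  opU_eq : ∀ z ∈ dom, ∀ (a : CSpace m → CSpace m) (s : CSpace m → F),
    AnalyticAt ℂ a z → AnalyticAt ℂ s z →
      (logNabla r conn a (fun w => opU w (s w)) z - opU z (logNabla r conn a s z))
        - (higgs z (a z) (opV z (s z)) - opV z (higgs z (a z) (s z)))
        + higgs z (a z) (s z) = 0
  metric_higgs : ∀ z ∈ dom, ∀ (x : CSpace m) (s t : F),
    metric z (higgs z x s) t = metric z s (higgs z x t)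
  metric_opU : ∀ z ∈ dom, ∀ s t : F, metric z (opU z s) t = metric z s (opU z t)
  metric_opV : ∀ z ∈ dom, ∀ s t : F, metric z (opV z s) t = - metric z s (opV z t)

/-- The covariant derivative `∇_X Y` of vector fields on an open subset of `ℂ^m`, for the
connection `∇ = d + Γ` on the tangent bundle. -/
noncomputable def covDeriv {m : ℕ} (Γ : CSpace m → CSpace m →L[ℂ] CSpace m →L[ℂ] CSpace m)
    (X Y : CSpace m → CSpace m) : CSpace m → CSpace m :=
  fun z => fderiv ℂ Y z (X z) + Γ z (X z) (Y z)

/-- The `(3,1)`-tensor `∇∘`: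
`(∇∘)(X, Y, Z) = ∇_X (Y ∘ Z) - (∇_X Y) ∘ Z - Y ∘ (∇_X Z)`. -/
noncomputable def covDerivMul {m : ℕ}
    (Γ mul : CSpace m → CSpace m →L[ℂ] CSpace m →L[ℂ] CSpace m)
    (X Y Z : CSpace m → CSpace m) : CSpace m → CSpace m :=
  fun z => covDeriv Γ X (fun w => mul w (Y w) (Z w)) z
    - mul z (covDeriv Γ X Y z) (Z z) - mul z (Y z) (covDeriv Γ X Z z)

/-- `(N, ∘, e, E, g)` is a Frobenius manifold with Levi-Civita connection `∇ = d + Γ`, where `N`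
is an open subset of `ℂ^m`; `d` is the number in `Lie_E g = (2 - d) g`.
`X`, `Y`, `Z` are arbitrary local holomorphic vector fields. -/
structure IsFrobeniusManifold {m : ℕ} (N : Set (CSpace m))
    (mul : CSpace m → CSpace m →L[ℂ] CSpace m →L[ℂ] CSpace m) (e E : CSpace m → CSpace m)
    (g : CSpace m → CSpace m →L[ℂ] CSpace m →L[ℂ] ℂ)
    (Γ : CSpace m → CSpace m →L[ℂ] CSpace m →L[ℂ] CSpace m) (d : ℂ) : Prop where
  isOpen : IsOpen N
  dim_pos : 1 ≤ m
  mul_analytic : AnalyticOnNhd ℂ mul N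
  e_analytic : AnalyticOnNhd ℂ e N
  E_analytic : AnalyticOnNhd ℂ E N
  g_analytic : AnalyticOnNhd ℂ g N
  conn_analytic : AnalyticOnNhd ℂ Γ N
  mul_comm : ∀ z ∈ N, ∀ x y : CSpace m, mul z x y = mul z y x
  mul_assoc : ∀ z ∈ N, ∀ x y w : CSpace m, mul z (mul z x y) w = mul z x (mul z y w)
  unit_mul : ∀ z ∈ N, ∀ x : CSpace m, mul z (e z) x = x
  g_symm : ∀ z ∈ N, ∀ x y : CSpace m, g z x y = g z y x
  g_nondeg : ∀ z ∈ N, ∀ x : CSpace m, (∀ y : CSpace m, g z x y = 0) → x = 0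
  /-- Levi-Civita: `∇` is torsion free -/
  conn_torsionFree : ∀ z ∈ N, ∀ X Y : CSpace m → CSpace m,
    AnalyticAt ℂ X z → AnalyticAt ℂ Y z →
      covDeriv Γ X Y z - covDeriv Γ Y X z = VectorField.lieBracket ℂ X Y z
  /-- Levi-Civita: `∇ g = 0` -/
  conn_metric : ∀ z ∈ N, ∀ X Y Z : CSpace m → CSpace m,
    AnalyticAt ℂ X z → AnalyticAt ℂ Y z → AnalyticAt ℂ Z z →
      fderiv ℂ (fun w => g w (Y w) (Z w)) z (X z) =
        g z (covDeriv Γ X Y z) (Z z) + g z (Y z) (covDeriv Γ X Z z)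
  g_invariant : ∀ z ∈ N, ∀ x y w : CSpace m, g z (mul z x y) w = g z x (mul z y w)
  /-- the `(3,1)`-tensor `∇∘` is symmetric -/
  potentiality : ∀ z ∈ N, ∀ X Y Z : CSpace m → CSpace m,
    AnalyticAt ℂ X z → AnalyticAt ℂ Y z → AnalyticAt ℂ Z z →
      covDerivMul Γ mul X Y Z z = covDerivMul Γ mul Y X Z z ∧
        covDerivMul Γ mul X Y Z z = covDerivMul Γ mul X Z Y z
  /-- `∇` is flat -/
  conn_flat : ∀ z ∈ N, ∀ X Y Z : CSpace m → CSpace m,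
    AnalyticAt ℂ X z → AnalyticAt ℂ Y z → AnalyticAt ℂ Z z →
      covDeriv Γ X (covDeriv Γ Y Z) z - covDeriv Γ Y (covDeriv Γ X Z) z
        - covDeriv Γ (VectorField.lieBracket ℂ X Y) Z z = 0
  /-- `∇ e = 0` -/
  unit_flat : ∀ z ∈ N, ∀ X : CSpace m → CSpace m, AnalyticAt ℂ X z → covDeriv Γ X e z = 0
  /-- `Lie_E(∘) = 1 · ∘` -/
  lie_mul : ∀ z ∈ N, ∀ X Y : CSpace m → CSpace m, AnalyticAt ℂ X z → AnalyticAt ℂ Y z →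
    VectorField.lieBracket ℂ E (fun w => mul w (X w) (Y w)) z
        - mul z (VectorField.lieBracket ℂ E X z) (Y z)
        - mul z (X z) (VectorField.lieBracket ℂ E Y z) = mul z (X z) (Y z)
  /-- `Lie_E(g) = (2 - d) · g` -/
  lie_g : ∀ z ∈ N, ∀ X Y : CSpace m → CSpace m, AnalyticAt ℂ X z → AnalyticAt ℂ Y z →
    fderiv ℂ (fun w => g w (X w) (Y w)) z (E z)
        - g z (VectorField.lieBracket ℂ E X z) (Y z)
        - g z (X z) (VectorField.lieBracket ℂ E Y z) = (2 - d) * g z (X z) (Y z)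

/-- Germ at `0 ∈ D = {z_1 ⋯ z_r = 0}` of a Frobenius manifold with logarithmic poles along `D`:
`dom \ D` is a Frobenius manifold, and `e`, `E`, `∘`, `g` extend over `D` to a section of
`Der(log D)`, again one, a multiplication on `Der(log D)`, and a pairing on `Der(log D)`
that is nondegenerate everywhere on `dom`. The fields ending in `Log` are these extensions,
written in the frame `δ`. The Levi-Civita connection is part of the data, with its logarithmic
connection form. -/
structure LogFrobeniusManifold (m r : ℕ) where
  dom : Set (CSpace m)
  isOpen_dom : IsOpen dom
  zero_mem : (0 : CSpace m) ∈ dom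
  r_pos : 0 < r
  r_le : r ≤ m
  /-- the Frobenius manifold off the divisor -/
  mul : CSpace m → CSpace m →L[ℂ] CSpace m →L[ℂ] CSpace m
  e : CSpace m → CSpace m
  E : CSpace m → CSpace m
  g : CSpace m → CSpace m →L[ℂ] CSpace m →L[ℂ] ℂ
  conn : CSpace m → CSpace m →L[ℂ] CSpace m →L[ℂ] CSpace m
  d : ℂ
  frobenius : IsFrobeniusManifold (dom \ ncDivisor m r) mul e E g conn d
  /-- the logarithmic extensions -/
  mulLog : CSpace m → CSpace m →L[ℂ] CSpace m →L[ℂ] CSpace m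
  eLog : CSpace m → CSpace m
  ELog : CSpace m → CSpace m
  gLog : CSpace m → CSpace m →L[ℂ] CSpace m →L[ℂ] ℂ
  connLog : CSpace m → CSpace m →L[ℂ] CSpace m →L[ℂ] CSpace m
  mulLog_analytic : AnalyticOnNhd ℂ mulLog dom
  eLog_analytic : AnalyticOnNhd ℂ eLog dom
  ELog_analytic : AnalyticOnNhd ℂ ELog dom
  gLog_analytic : AnalyticOnNhd ℂ gLog dom
  connLog_analytic : AnalyticOnNhd ℂ connLog dom
  mul_eq : ∀ z ∈ dom \ ncDivisor m r, ∀ x y : CSpace m,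
    mul z (logFrame r z x) (logFrame r z y) = logFrame r z (mulLog z x y)
  e_eq : ∀ z ∈ dom \ ncDivisor m r, e z = logFrame r z (eLog z)
  E_eq : ∀ z ∈ dom \ ncDivisor m r, E z = logFrame r z (ELog z)
  g_eq : ∀ z ∈ dom \ ncDivisor m r, ∀ x y : CSpace m,
    g z (logFrame r z x) (logFrame r z y) = gLog z x y
  conn_eq : ∀ z ∈ dom \ ncDivisor m r, ∀ a b : CSpace m → CSpace m,
    AnalyticAt ℂ a z → AnalyticAt ℂ b z →
      covDeriv conn (logField r a) (logField r b) z =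
        logFrame r z (logNabla r connLog a b z)
  gLog_nondeg : ∀ z ∈ dom, ∀ x : CSpace m, (∀ y : CSpace m, gLog z x y = 0) → x = 0

/-- The bundle map `v : Der(log D) → K`, `X ↦ -C_X ξ`, on the fibres at `z`. -/
noncomputable def LogFrobeniusTypeStructure.vMap {m r : ℕ} {F : Type*} [NormedAddCommGroup F]
    [NormedSpace ℂ F] [FiniteDimensional ℂ F] (S : LogFrobeniusTypeStructure m r F)
    (ξ : CSpace m → F) (z : CSpace m) : CSpace m → F :=
  fun a => - S.higgs z a (ξ z)

/-- `S` corresponds to the logarithmic Frobenius manifold `M` through `v : X ↦ -C_X ξ`: the map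
`v` is an isomorphism `Der(log D) → K` of bundles over `M.dom`, which carries `e` to `ξ`,
`E` to `𝒰 ξ`, and identifies the natural structure on `Der(log D)`,
`(∇^g, C_X Y = - X ∘ Y, E ∘, ∇^g_• E - (2 - d)/2, g)`, with
`(∇^r, C, 𝒰, 𝒱, g)`. -/
structure LogFrobeniusTypeStructure.CorrespondsTo {m r : ℕ} {F : Type*} [NormedAddCommGroup F]
    [NormedSpace ℂ F] [FiniteDimensional ℂ F] (S : LogFrobeniusTypeStructure m r F)
    (ξ : CSpace m → F) (M : LogFrobeniusManifold m r) : Prop where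
  dom_subset : M.dom ⊆ S.dom
  bijective : ∀ z ∈ M.dom, Function.Bijective (S.vMap ξ z)
  unit : ∀ z ∈ M.dom, S.vMap ξ z (M.eLog z) = ξ z
  euler : ∀ z ∈ M.dom, S.vMap ξ z (M.ELog z) = S.opU z (ξ z)
  nabla : ∀ z ∈ M.dom, ∀ a b : CSpace m → CSpace m, AnalyticAt ℂ a z → AnalyticAt ℂ b z →
    S.vMap ξ z (logNabla r M.connLog a b z) =
      logNabla r S.conn a (fun w => S.vMap ξ w (b w)) z
  mul : ∀ z ∈ M.dom, ∀ x y : CSpace m,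
    S.vMap ξ z (M.mulLog z x y) = - S.higgs z x (S.vMap ξ z y)
  metric : ∀ z ∈ M.dom, ∀ x y : CSpace m,
    M.gLog z x y = S.metric z (S.vMap ξ z x) (S.vMap ξ z y)
  opU : ∀ z ∈ M.dom, ∀ x : CSpace m,
    S.vMap ξ z (M.mulLog z (M.ELog z) x) = S.opU z (S.vMap ξ z x)
  opV : ∀ z ∈ M.dom, ∀ x : CSpace m,
    S.vMap ξ z (logNabla r M.connLog (fun _ => x) M.ELog z - ((2 - M.d) / 2) • x) =
      S.opV z (S.vMap ξ z x)

/-!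
The bundle map `v : X ↦ -C_X ξ` is invertible at the base point, hence on a neighbourhood `U`, with
holomorphic inverse `Q`. The whole structure on `Der(log D)` is forced by transport through `v`:
`∇^g = v⁻¹ ∇^r v`, `X ∘ Y = v⁻¹(-C_X v(Y))`, `e = v⁻¹ ξ`, `E = v⁻¹(𝒰 ξ)`, `g̃ = g(v, v)`. Every axiom
is an identity between germs and is checked after applying the injective map `v`.

* Since `[C_X, C_Y] = 0` and `ξ` generates, `C_{X ∘ Y} = -C_X C_Y` (`higgs_mul`), which gives a
  commutative associative multiplication with unit `e`; likewise `C_E = -𝒰` (`higgs_euler`).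
* The potential equation `∇^r_X(C_Y) - ∇^r_Y(C_X) = C_{[X,Y]}`, applied to the flat section `ξ`, says
  that `∇^g` is torsion free (`torsionFree`); applied to `v(Z)`, it says that `∇^g(∘)` is symmetric
  (`potentiality`). Flatness and metricity of `∇^g` are those of `∇^r`.
* The equation for `∇^r 𝒰`, applied to `ξ` with `𝒱 ξ = (d/2) ξ`, gives `∇^g E = 𝒱 + (2 - d)/2`
  (`v_nabla_euler`). Together with torsion-freeness, potentiality and the antisymmetry of `𝒱` it
  yields `Lie_E(∘) = ∘` and `Lie_E(g̃) = (2 - d) g̃` (`lie_mul`, `lie_g`).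

All this is done in the logarithmic frame, across the divisor, where `ξ` is still flat because the
complement of `D` is dense (`flat_of_flat_off_divisor`). Off the divisor the logarithmic frame is a
frame of the tangent bundle and every vector field is logarithmic, so the identities turn into the
axioms of a Frobenius manifold (`IsLogFrobenius.isFrobeniusManifold`).
-/

/-! ### Analyticity of operator-valued functions and of the logarithmic frame -/

section Analytic

variable {X G H K L : Type*} [NormedAddCommGroup X] [NormedSpace ℂ X]
  [NormedAddCommGroup G] [NormedSpace ℂ G] [NormedAddCommGroup H] [NormedSpace ℂ H]
  [NormedAddCommGroup K] [NormedSpace ℂ K] [NormedAddCommGroup L] [NormedSpace ℂ L]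

theorem analyticAt_clm_apply {T : X → G →L[ℂ] H} {f : X → G} {z : X}
    (hT : AnalyticAt ℂ T z) (hf : AnalyticAt ℂ f z) :
    AnalyticAt ℂ (fun w => T w (f w)) z :=
  AnalyticAt.comp₂ (h := fun p : (G →L[ℂ] H) × G => p.1 p.2)
    ((ContinuousLinearMap.id ℂ (G →L[ℂ] H)).analyticAt_bilinear (T z, f z)) hT hf

theorem analyticAt_clm_comp {T : X → H →L[ℂ] K} {R : X → G →L[ℂ] H} {z : X}
    (hT : AnalyticAt ℂ T z) (hR : AnalyticAt ℂ R z) :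
    AnalyticAt ℂ (fun w => (T w).comp (R w)) z :=
  AnalyticAt.comp₂ (h := fun p : (H →L[ℂ] K) × (G →L[ℂ] H) => p.1.comp p.2)
    ((ContinuousLinearMap.compL ℂ G H K).analyticAt_bilinear (T z, R z)) hT hR

/-- The bilinear map `(x, y) ↦ Q (B x (P y))`: a bilinear map `B` with its second argument
transported by `P` and its value by `Q`. -/
noncomputable def conjBilin (Q : K →L[ℂ] L) (B : X →L[ℂ] H →L[ℂ] K) (P : G →L[ℂ] H) :
    X →L[ℂ] G →L[ℂ] L :=
  (ContinuousLinearMap.compL ℂ G K L Q).comp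
    (((ContinuousLinearMap.compL ℂ G H K).flip P).comp B)

@[simp] theorem conjBilin_apply (Q : K →L[ℂ] L) (B : X →L[ℂ] H →L[ℂ] K) (P : G →L[ℂ] H)
    (x : X) (y : G) : conjBilin Q B P x y = Q (B x (P y)) := rfl

set_option maxSynthPendingDepth 3 in
theorem analyticAt_conjBilin {Y : Type*} [NormedAddCommGroup Y] [NormedSpace ℂ Y]
    {Q : Y → K →L[ℂ] L} {B : Y → X →L[ℂ] H →L[ℂ] K} {P : Y → G →L[ℂ] H} {z : Y}
    (hQ : AnalyticAt ℂ Q z) (hB : AnalyticAt ℂ B z) (hP : AnalyticAt ℂ P z) :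
    AnalyticAt ℂ (fun w => conjBilin (Q w) (B w) (P w)) z :=
  analyticAt_clm_comp
    (((ContinuousLinearMap.compL ℂ G K L).analyticAt _).comp hQ)
    (analyticAt_clm_comp
      (((ContinuousLinearMap.compL ℂ G H K).flip.analyticAt _).comp hP)
      hB)

end Analytic

section Frame

variable {m : ℕ}

theorem analyticAt_diag {c : Fin m → CSpace m → ℂ} {z : CSpace m}
    (hc : ∀ i, AnalyticAt ℂ (c i) z) :
    AnalyticAt ℂ (fun w => (ContinuousLinearMap.pi fun i : Fin m =>
      c i w • (ContinuousLinearMap.proj i : CSpace m →L[ℂ] ℂ))) z := by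
  have h : (fun w => (ContinuousLinearMap.pi fun i : Fin m =>
      c i w • (ContinuousLinearMap.proj i : CSpace m →L[ℂ] ℂ))) = fun w =>
      ∑ i : Fin m, c i w • ((ContinuousLinearMap.single ℂ (fun _ : Fin m => ℂ) i).comp
        (ContinuousLinearMap.proj i : CSpace m →L[ℂ] ℂ)) := by
    funext w
    ext x j
    simp [Finset.sum_apply, Pi.single_apply]
  rw [h]
  exact Finset.analyticAt_fun_sum _ fun i _ => (hc i).smul analyticAt_const

theorem analyticAt_coord (i : Fin m) (z : CSpace m) :
    AnalyticAt ℂ (fun w : CSpace m => w i) z :=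
  (ContinuousLinearMap.proj i : CSpace m →L[ℂ] ℂ).analyticAt z

theorem analyticAt_logFrame (r : ℕ) (z : CSpace m) :
    AnalyticAt ℂ (logFrame (m := m) r) z := by
  refine analyticAt_diag (c := fun i w => if i.val < r then w i else 1) fun i => ?_
  by_cases hi : i.val < r
  · simpa [hi] using analyticAt_coord i z
  · simpa [hi] using analyticAt_const

/-- The inverse of `logFrame r z` off the divisor: the coefficients of a tangent vector in the
logarithmic frame. -/
noncomputable def logCoframe (r : ℕ) (z : CSpace m) : CSpace m →L[ℂ] CSpace m :=
  ContinuousLinearMap.pi fun i : Fin m =>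
    (if i.val < r then z i else 1)⁻¹ • (ContinuousLinearMap.proj i : CSpace m →L[ℂ] ℂ)

theorem frame_ne_zero {r : ℕ} {z : CSpace m} (hz : z ∉ ncDivisor m r) (i : Fin m) :
    (if i.val < r then z i else 1) ≠ 0 := by
  by_cases hi : i.val < r
  · simpa [hi] using fun h => hz ⟨i, hi, h⟩
  · simp [hi]

theorem logFrame_logCoframe {r : ℕ} {z : CSpace m} (hz : z ∉ ncDivisor m r) (x : CSpace m) :
    logFrame r z (logCoframe r z x) = x := by
  funext i
  have := frame_ne_zero hz i
  simp only [logFrame, logCoframe, ContinuousLinearMap.pi_apply, smul_apply,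
    ContinuousLinearMap.proj_apply, smul_eq_mul]
  field_simp

theorem logCoframe_logFrame {r : ℕ} {z : CSpace m} (hz : z ∉ ncDivisor m r) (x : CSpace m) :
    logCoframe r z (logFrame r z x) = x := by
  funext i
  have := frame_ne_zero hz i
  simp only [logFrame, logCoframe, ContinuousLinearMap.pi_apply, smul_apply,
    ContinuousLinearMap.proj_apply, smul_eq_mul]
  field_simp

theorem analyticAt_logCoframe {r : ℕ} {z : CSpace m} (hz : z ∉ ncDivisor m r) :
    AnalyticAt ℂ (logCoframe (m := m) r) z := by
  refine analyticAt_diag (c := fun i w => (if i.val < r then w i else 1)⁻¹) fun i => ?_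
  refine AnalyticAt.fun_inv ?_ (frame_ne_zero hz i)
  by_cases hi : i.val < r
  · simpa [hi] using analyticAt_coord i z
  · simpa [hi] using analyticAt_const

theorem isClosed_ncDivisor (m r : ℕ) : IsClosed (ncDivisor m r) := by
  have h : ncDivisor m r = ⋃ i ∈ {i : Fin m | i.val < r}, {z : CSpace m | z i = 0} := by
    ext z
    simp [ncDivisor]
  rw [h]
  exact (Set.toFinite _).isClosed_biUnion fun i _ =>
    isClosed_eq (continuous_apply i) continuous_const

theorem dense_compl_ncDivisor (m r : ℕ) : Dense (ncDivisor m r)ᶜ := by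
  intro z
  -- the points `z + (t, …, t)` with `t ≠ 0` small lie off the divisor and tend to `z`
  have hlim : Filter.Tendsto (fun t : ℂ => z + fun _ : Fin m => t) (nhdsWithin 0 {0}ᶜ) (nhds z) := by
    have h : Continuous fun t : ℂ => z + fun _ : Fin m => t := by fun_prop
    have h0 := h.tendsto 0
    rw [show (z + fun _ : Fin m => (0 : ℂ)) = z from add_zero z] at h0
    exact h0.mono_left nhdsWithin_le_nhds
  refine mem_closure_of_tendsto hlim ?_
  have h : ∀ i : Fin m, ∀ᶠ t in nhdsWithin (0 : ℂ) {0}ᶜ, z i + t ≠ 0 := by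
    intro i
    by_cases hi : z i = 0
    · filter_upwards [self_mem_nhdsWithin] with t ht
      simpa [hi] using ht
    · have hc : ContinuousAt (fun t : ℂ => z i + t) 0 := by fun_prop
      exact (hc.eventually_ne (by simpa using hi)).filter_mono nhdsWithin_le_nhds
  filter_upwards [Filter.eventually_all.2 h] with t ht
  rintro ⟨i, _, hi⟩
  exact ht i hi

end Frame

/-! ### Covariant derivatives along logarithmic vector fields -/

section Nabla

variable {m r : ℕ} {V : Type*} [NormedAddCommGroup V] [NormedSpace ℂ V]
  {a b : CSpace m → CSpace m} {z : CSpace m}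

theorem analyticAt_logField (ha : AnalyticAt ℂ a z) : AnalyticAt ℂ (logField r a) z :=
  analyticAt_clm_apply (analyticAt_logFrame r z) ha

theorem analyticAt_logDirDeriv [CompleteSpace V] {s : CSpace m → V} (ha : AnalyticAt ℂ a z)
    (hs : AnalyticAt ℂ s z) : AnalyticAt ℂ (logDirDeriv r a s) z :=
  analyticAt_clm_apply hs.fderiv (analyticAt_logField ha)

theorem analyticAt_logNabla [CompleteSpace V] {A : CSpace m → CSpace m →L[ℂ] V →L[ℂ] V}
    {s : CSpace m → V} (hA : AnalyticAt ℂ A z) (ha : AnalyticAt ℂ a z) (hs : AnalyticAt ℂ s z) :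
    AnalyticAt ℂ (logNabla r A a s) z :=
  (analyticAt_logDirDeriv ha hs).add (analyticAt_clm_apply (analyticAt_clm_apply hA ha) hs)

theorem analyticAt_logBracket (ha : AnalyticAt ℂ a z) (hb : AnalyticAt ℂ b z) :
    AnalyticAt ℂ (logBracket r a b) z :=
  (analyticAt_logDirDeriv ha hb).sub (analyticAt_logDirDeriv hb ha)

theorem logNabla_neg (A : CSpace m → CSpace m →L[ℂ] V →L[ℂ] V) (s : CSpace m → V) :
    logNabla r A a (fun w => - s w) z = - logNabla r A a s z := by
  simp only [logNabla, logDirDeriv, fderiv_fun_neg, neg_apply, map_neg]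
  abel

theorem logNabla_congr (A : CSpace m → CSpace m →L[ℂ] V →L[ℂ] V) {s t : CSpace m → V}
    (h : s =ᶠ[nhds z] t) : logNabla r A a s z = logNabla r A a t z := by
  simp only [logNabla, logDirDeriv, h.fderiv_eq, h.eq_of_nhds]

theorem logNabla_congr_left (A : CSpace m → CSpace m →L[ℂ] V →L[ℂ] V) {s : CSpace m → V}
    (h : a z = b z) : logNabla r A a s z = logNabla r A b s z := by
  simp only [logNabla, logDirDeriv, logField, h]

theorem covDeriv_congr {Γ : CSpace m → CSpace m →L[ℂ] CSpace m →L[ℂ] CSpace m}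
    {X Y Y' : CSpace m → CSpace m} (h : Y =ᶠ[nhds z] Y') :
    covDeriv Γ X Y z = covDeriv Γ X Y' z := by
  simp only [covDeriv, h.fderiv_eq, h.eq_of_nhds]

end Nabla

/-! ### Frobenius structures on the logarithmic tangent bundle -/

/-- The axioms of a Frobenius manifold for data on the bundle `Der(log D)` over an open set `N`,
written in the logarithmic frame: vector fields are replaced by their coefficient functions,
directional derivatives, the covariant derivative and the Lie bracket by `logDirDeriv`,
`logNabla` and `logBracket`. Unlike `IsFrobeniusManifold` this makes sense across the divisor. -/
structure IsLogFrobenius {m : ℕ} (r : ℕ) (N : Set (CSpace m))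
    (mul : CSpace m → CSpace m →L[ℂ] CSpace m →L[ℂ] CSpace m) (e E : CSpace m → CSpace m)
    (g : CSpace m → CSpace m →L[ℂ] CSpace m →L[ℂ] ℂ)
    (Γ : CSpace m → CSpace m →L[ℂ] CSpace m →L[ℂ] CSpace m) (d : ℂ) : Prop where
  isOpen : IsOpen N
  mul_analytic : AnalyticOnNhd ℂ mul N
  e_analytic : AnalyticOnNhd ℂ e N
  E_analytic : AnalyticOnNhd ℂ E N
  g_analytic : AnalyticOnNhd ℂ g N
  conn_analytic : AnalyticOnNhd ℂ Γ N
  mul_comm : ∀ z ∈ N, ∀ x y : CSpace m, mul z x y = mul z y x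
  mul_assoc : ∀ z ∈ N, ∀ x y w : CSpace m, mul z (mul z x y) w = mul z x (mul z y w)
  unit_mul : ∀ z ∈ N, ∀ x : CSpace m, mul z (e z) x = x
  g_symm : ∀ z ∈ N, ∀ x y : CSpace m, g z x y = g z y x
  g_nondeg : ∀ z ∈ N, ∀ x : CSpace m, (∀ y : CSpace m, g z x y = 0) → x = 0
  torsionFree : ∀ z ∈ N, ∀ a b : CSpace m → CSpace m, AnalyticAt ℂ a z → AnalyticAt ℂ b z →
    logNabla r Γ a b z - logNabla r Γ b a z = logBracket r a b z
  conn_metric : ∀ z ∈ N, ∀ a b c : CSpace m → CSpace m,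
    AnalyticAt ℂ a z → AnalyticAt ℂ b z → AnalyticAt ℂ c z →
      logDirDeriv r a (fun w => g w (b w) (c w)) z =
        g z (logNabla r Γ a b z) (c z) + g z (b z) (logNabla r Γ a c z)
  g_invariant : ∀ z ∈ N, ∀ x y w : CSpace m, g z (mul z x y) w = g z x (mul z y w)
  potentiality : ∀ z ∈ N, ∀ a b c : CSpace m → CSpace m,
    AnalyticAt ℂ a z → AnalyticAt ℂ b z → AnalyticAt ℂ c z →
      logNabla r Γ a (fun w => mul w (b w) (c w)) z
          - mul z (logNabla r Γ a b z) (c z) - mul z (b z) (logNabla r Γ a c z) =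
        logNabla r Γ b (fun w => mul w (a w) (c w)) z
          - mul z (logNabla r Γ b a z) (c z) - mul z (a z) (logNabla r Γ b c z)
  conn_flat : ∀ z ∈ N, ∀ a b c : CSpace m → CSpace m,
    AnalyticAt ℂ a z → AnalyticAt ℂ b z → AnalyticAt ℂ c z →
      logNabla r Γ a (logNabla r Γ b c) z - logNabla r Γ b (logNabla r Γ a c) z
        - logNabla r Γ (logBracket r a b) c z = 0
  unit_flat : ∀ z ∈ N, ∀ a : CSpace m → CSpace m, logNabla r Γ a e z = 0
  lie_mul : ∀ z ∈ N, ∀ a b : CSpace m → CSpace m, AnalyticAt ℂ a z → AnalyticAt ℂ b z →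
    logBracket r E (fun w => mul w (a w) (b w)) z
        - mul z (logBracket r E a z) (b z) - mul z (a z) (logBracket r E b z) =
      mul z (a z) (b z)
  lie_g : ∀ z ∈ N, ∀ a b : CSpace m → CSpace m, AnalyticAt ℂ a z → AnalyticAt ℂ b z →
    logDirDeriv r E (fun w => g w (a w) (b w)) z
        - g z (logBracket r E a z) (b z) - g z (a z) (logBracket r E b z) =
      (2 - d) * g z (a z) (b z)

section Transport

variable {m : ℕ}

/-- The bilinear map `B z` on coefficients, seen as a map on tangent vectors off the divisor. -/
noncomputable def offDivisorMul (r : ℕ) (B : CSpace m → CSpace m →L[ℂ] CSpace m →L[ℂ] CSpace m)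
    (z : CSpace m) : CSpace m →L[ℂ] CSpace m →L[ℂ] CSpace m :=
  conjBilin (logFrame r z) ((B z).comp (logCoframe r z)) (logCoframe r z)

/-- The pairing `B z` on coefficients, seen as a pairing of tangent vectors off the divisor. -/
noncomputable def offDivisorForm (r : ℕ) (B : CSpace m → CSpace m →L[ℂ] CSpace m →L[ℂ] ℂ)
    (z : CSpace m) : CSpace m →L[ℂ] CSpace m →L[ℂ] ℂ :=
  conjBilin (ContinuousLinearMap.id ℂ ℂ) ((B z).comp (logCoframe r z)) (logCoframe r z)

/-- The connection form, in the coordinate frame `∂_i` off the divisor, of the connection with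
logarithmic connection form `Γ` in the frame `δ_i`. The second term is the usual inhomogeneous
term of a gauge transformation. -/
noncomputable def offDivisorConn (r : ℕ) (Γ : CSpace m → CSpace m →L[ℂ] CSpace m →L[ℂ] CSpace m)
    (z : CSpace m) : CSpace m →L[ℂ] CSpace m →L[ℂ] CSpace m :=
  offDivisorMul r Γ z -
    conjBilin (ContinuousLinearMap.id ℂ (CSpace m)) (fderiv ℂ (logFrame r) z) (logCoframe r z)

variable {r : ℕ} {z : CSpace m}

theorem analyticAt_offDivisorMul {B : CSpace m → CSpace m →L[ℂ] CSpace m →L[ℂ] CSpace m}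
    (hB : AnalyticAt ℂ B z) (hz : z ∉ ncDivisor m r) : AnalyticAt ℂ (offDivisorMul r B) z :=
  analyticAt_conjBilin (analyticAt_logFrame r z)
    (analyticAt_clm_comp hB (analyticAt_logCoframe hz)) (analyticAt_logCoframe hz)

theorem analyticAt_offDivisorForm {B : CSpace m → CSpace m →L[ℂ] CSpace m →L[ℂ] ℂ}
    (hB : AnalyticAt ℂ B z) (hz : z ∉ ncDivisor m r) : AnalyticAt ℂ (offDivisorForm r B) z :=
  analyticAt_conjBilin analyticAt_const
    (analyticAt_clm_comp hB (analyticAt_logCoframe hz)) (analyticAt_logCoframe hz)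

theorem analyticAt_offDivisorConn {Γ : CSpace m → CSpace m →L[ℂ] CSpace m →L[ℂ] CSpace m}
    (hΓ : AnalyticAt ℂ Γ z) (hz : z ∉ ncDivisor m r) : AnalyticAt ℂ (offDivisorConn r Γ) z :=
  (analyticAt_offDivisorMul hΓ hz).sub
    (analyticAt_conjBilin analyticAt_const (analyticAt_logFrame r z).fderiv
      (analyticAt_logCoframe hz))

theorem offDivisorMul_logFrame (B : CSpace m → CSpace m →L[ℂ] CSpace m →L[ℂ] CSpace m)
    (hz : z ∉ ncDivisor m r) (x y : CSpace m) :
    offDivisorMul r B z (logFrame r z x) (logFrame r z y) = logFrame r z (B z x y) := by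
  simp [offDivisorMul, logCoframe_logFrame hz]

theorem offDivisorForm_logFrame (B : CSpace m → CSpace m →L[ℂ] CSpace m →L[ℂ] ℂ)
    (hz : z ∉ ncDivisor m r) (x y : CSpace m) :
    offDivisorForm r B z (logFrame r z x) (logFrame r z y) = B z x y := by
  simp [offDivisorForm, logCoframe_logFrame hz]

theorem covDeriv_logField (Γ : CSpace m → CSpace m →L[ℂ] CSpace m →L[ℂ] CSpace m)
    (hz : z ∉ ncDivisor m r) (a : CSpace m → CSpace m) {b : CSpace m → CSpace m}
    (hb : DifferentiableAt ℂ b z) :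
    covDeriv (offDivisorConn r Γ) (logField r a) (logField r b) z =
      logFrame r z (logNabla r Γ a b z) := by
  have hd : fderiv ℂ (logField r b) z = _ :=
    ((analyticAt_logFrame r z).differentiableAt.hasFDerivAt.clm_apply hb.hasFDerivAt).fderiv
  rw [covDeriv, hd]
  simp [offDivisorConn, logField, offDivisorMul_logFrame Γ hz, logCoframe_logFrame hz, logNabla,
    logDirDeriv]

/-- The germ at `z` of the vector field `X` is logarithmic, with holomorphic coefficients `a`. -/
def IsLogGerm (r : ℕ) (z : CSpace m) (X a : CSpace m → CSpace m) : Prop :=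
  AnalyticAt ℂ a z ∧ X =ᶠ[nhds z] logField r a

theorem isLogGerm_logField {a : CSpace m → CSpace m} (ha : AnalyticAt ℂ a z) :
    IsLogGerm r z (logField r a) a :=
  ⟨ha, Filter.EventuallyEq.rfl⟩

/-- Off the divisor every holomorphic vector field is logarithmic. -/
theorem exists_isLogGerm {X : CSpace m → CSpace m} (hz : z ∉ ncDivisor m r)
    (hX : AnalyticAt ℂ X z) : ∃ a, IsLogGerm r z X a := by
  refine ⟨fun w => logCoframe r w (X w), analyticAt_clm_apply (analyticAt_logCoframe hz) hX, ?_⟩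
  filter_upwards [(isClosed_ncDivisor m r).isOpen_compl.mem_nhds hz] with w hw
  exact (logFrame_logCoframe hw (X w)).symm

namespace IsLogGerm

variable {X Y a b : CSpace m → CSpace m}

theorem eq (h : IsLogGerm r z X a) : X z = logFrame r z (a z) :=
  h.2.eq_of_nhds

theorem mul {B : CSpace m → CSpace m →L[ℂ] CSpace m →L[ℂ] CSpace m} (hB : AnalyticAt ℂ B z)
    (hz : z ∉ ncDivisor m r) (hX : IsLogGerm r z X a) (hY : IsLogGerm r z Y b) :
    IsLogGerm r z (fun w => offDivisorMul r B w (X w) (Y w)) (fun w => B w (a w) (b w)) := by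
  refine ⟨analyticAt_clm_apply (analyticAt_clm_apply hB hX.1) hY.1, ?_⟩
  filter_upwards [(isClosed_ncDivisor m r).isOpen_compl.mem_nhds hz, hX.2, hY.2] with w hw h1 h2
  rw [h1, h2]
  exact offDivisorMul_logFrame B hw (a w) (b w)

theorem form (B : CSpace m → CSpace m →L[ℂ] CSpace m →L[ℂ] ℂ) (hz : z ∉ ncDivisor m r)
    (hX : IsLogGerm r z X a) (hY : IsLogGerm r z Y b) :
    (fun w => offDivisorForm r B w (X w) (Y w)) =ᶠ[nhds z] fun w => B w (a w) (b w) := by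
  filter_upwards [(isClosed_ncDivisor m r).isOpen_compl.mem_nhds hz, hX.2, hY.2] with w hw h1 h2
  rw [h1, h2]
  exact offDivisorForm_logFrame B hw (a w) (b w)

theorem fderiv_apply {V : Type*} [NormedAddCommGroup V] [NormedSpace ℂ V]
    (hX : IsLogGerm r z X a) {f f' : CSpace m → V} (hf : f =ᶠ[nhds z] f') :
    fderiv ℂ f z (X z) = logDirDeriv r a f' z := by
  rw [hf.fderiv_eq, hX.eq]
  rfl

theorem covDeriv {Γ : CSpace m → CSpace m →L[ℂ] CSpace m →L[ℂ] CSpace m} (hΓ : AnalyticAt ℂ Γ z)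
    (hz : z ∉ ncDivisor m r) (hX : IsLogGerm r z X a) (hY : IsLogGerm r z Y b) :
    IsLogGerm r z (_root_.covDeriv (offDivisorConn r Γ) X Y) (logNabla r Γ a b) := by
  refine ⟨analyticAt_logNabla hΓ hX.1 hY.1, ?_⟩
  filter_upwards [(isClosed_ncDivisor m r).isOpen_compl.mem_nhds hz, hX.2,
    hY.2.eventuallyEq_nhds, hY.1.eventually_analyticAt] with w hw h1 h2 h3
  rw [covDeriv_congr h2]
  refine Eq.trans ?_ (covDeriv_logField Γ hw a h3.differentiableAt)
  simp only [_root_.covDeriv, h1]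

theorem lieBracket (hX : IsLogGerm r z X a) (hY : IsLogGerm r z Y b) :
    IsLogGerm r z (VectorField.lieBracket ℂ X Y) (logBracket r a b) := by
  refine ⟨analyticAt_logBracket hX.1 hY.1, ?_⟩
  filter_upwards [hX.2.eventuallyEq_nhds, hY.2.eventuallyEq_nhds, hX.1.eventually_analyticAt,
    hY.1.eventually_analyticAt] with w h1 h2 h3 h4
  rw [h1.lieBracket_vectorField_eq h2]
  exact (logField_logBracket r a b w h3.differentiableAt h4.differentiableAt).symm

end IsLogGerm

/-- Off the divisor, a Frobenius structure on `Der(log D)` is a Frobenius manifold. -/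
theorem IsLogFrobenius.isFrobeniusManifold {N : Set (CSpace m)}
    {mul : CSpace m → CSpace m →L[ℂ] CSpace m →L[ℂ] CSpace m} {e E : CSpace m → CSpace m}
    {g : CSpace m → CSpace m →L[ℂ] CSpace m →L[ℂ] ℂ}
    {Γ : CSpace m → CSpace m →L[ℂ] CSpace m →L[ℂ] CSpace m} {d : ℂ}
    (h : IsLogFrobenius r N mul e E g Γ d) (hm : 1 ≤ m) :
    IsFrobeniusManifold (N \ ncDivisor m r) (offDivisorMul r mul) (logField r e) (logField r E)
      (offDivisorForm r g) (offDivisorConn r Γ) d := by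
  have hsurj : ∀ z ∉ ncDivisor m r, ∀ x : CSpace m, ∃ a, x = logFrame r z a := fun z hz x =>
    ⟨logCoframe r z x, (logFrame_logCoframe hz x).symm⟩
  constructor
  case isOpen => exact h.isOpen.sdiff (isClosed_ncDivisor m r)
  case dim_pos => exact hm
  case mul_analytic => exact fun z hz => analyticAt_offDivisorMul (h.mul_analytic z hz.1) hz.2
  case e_analytic => exact fun z hz => analyticAt_logField (h.e_analytic z hz.1)
  case E_analytic => exact fun z hz => analyticAt_logField (h.E_analytic z hz.1)
  case g_analytic => exact fun z hz => analyticAt_offDivisorForm (h.g_analytic z hz.1) hz.2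
  case conn_analytic => exact fun z hz => analyticAt_offDivisorConn (h.conn_analytic z hz.1) hz.2
  case mul_comm =>
    rintro z ⟨hz, hD⟩ x y
    obtain ⟨x, rfl⟩ := hsurj z hD x
    obtain ⟨y, rfl⟩ := hsurj z hD y
    simp only [offDivisorMul_logFrame _ hD, h.mul_comm z hz x y]
  case mul_assoc =>
    rintro z ⟨hz, hD⟩ x y w
    obtain ⟨x, rfl⟩ := hsurj z hD x
    obtain ⟨y, rfl⟩ := hsurj z hD y
    obtain ⟨w, rfl⟩ := hsurj z hD w
    simp only [offDivisorMul_logFrame _ hD, h.mul_assoc z hz x y w]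
  case unit_mul =>
    rintro z ⟨hz, hD⟩ x
    obtain ⟨x, rfl⟩ := hsurj z hD x
    simp only [logField, offDivisorMul_logFrame _ hD, h.unit_mul z hz x]
  case g_symm =>
    rintro z ⟨hz, hD⟩ x y
    obtain ⟨x, rfl⟩ := hsurj z hD x
    obtain ⟨y, rfl⟩ := hsurj z hD y
    simp only [offDivisorForm_logFrame _ hD, h.g_symm z hz x y]
  case g_nondeg =>
    rintro z ⟨hz, hD⟩ x hx
    obtain ⟨x, rfl⟩ := hsurj z hD x
    rw [h.g_nondeg z hz x fun y => by
      simpa only [offDivisorForm_logFrame _ hD] using hx (logFrame r z y), map_zero]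
  case conn_torsionFree =>
    rintro z ⟨hz, hD⟩ X Y hX hY
    obtain ⟨a, ha⟩ := exists_isLogGerm hD hX
    obtain ⟨b, hb⟩ := exists_isLogGerm hD hY
    have hΓ := h.conn_analytic z hz
    rw [(ha.covDeriv hΓ hD hb).eq, (hb.covDeriv hΓ hD ha).eq, (ha.lieBracket hb).eq, ← map_sub,
      h.torsionFree z hz a b ha.1 hb.1]
  case conn_metric =>
    rintro z ⟨hz, hD⟩ X Y Z hX hY hZ
    obtain ⟨a, ha⟩ := exists_isLogGerm hD hX
    obtain ⟨b, hb⟩ := exists_isLogGerm hD hY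
    obtain ⟨c, hc⟩ := exists_isLogGerm hD hZ
    have hΓ := h.conn_analytic z hz
    rw [ha.fderiv_apply (hb.form g hD hc), (ha.covDeriv hΓ hD hb).eq, (ha.covDeriv hΓ hD hc).eq,
      hb.eq, hc.eq, offDivisorForm_logFrame g hD, offDivisorForm_logFrame g hD,
      h.conn_metric z hz a b c ha.1 hb.1 hc.1]
  case g_invariant =>
    rintro z ⟨hz, hD⟩ x y w
    obtain ⟨x, rfl⟩ := hsurj z hD x
    obtain ⟨y, rfl⟩ := hsurj z hD y
    obtain ⟨w, rfl⟩ := hsurj z hD w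
    simp only [offDivisorMul_logFrame _ hD, offDivisorForm_logFrame _ hD,
      h.g_invariant z hz x y w]
  case potentiality =>
    rintro z ⟨hz, hD⟩ X Y Z hX hY hZ
    obtain ⟨a, ha⟩ := exists_isLogGerm hD hX
    obtain ⟨b, hb⟩ := exists_isLogGerm hD hY
    obtain ⟨c, hc⟩ := exists_isLogGerm hD hZ
    have hΓ := h.conn_analytic z hz
    have hmul := h.mul_analytic z hz
    have key : ∀ {X Y Z a b c : CSpace m → CSpace m}, IsLogGerm r z X a → IsLogGerm r z Y b →
        IsLogGerm r z Z c →
        covDerivMul (offDivisorConn r Γ) (offDivisorMul r mul) X Y Z z =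
          logFrame r z (logNabla r Γ a (fun w => mul w (b w) (c w)) z
            - mul z (logNabla r Γ a b z) (c z) - mul z (b z) (logNabla r Γ a c z)) := by
      intro X Y Z a b c ha hb hc
      rw [covDerivMul, (ha.covDeriv hΓ hD (hb.mul hmul hD hc)).eq, (ha.covDeriv hΓ hD hb).eq,
        (ha.covDeriv hΓ hD hc).eq, hb.eq, hc.eq, offDivisorMul_logFrame _ hD,
        offDivisorMul_logFrame _ hD, map_sub, map_sub]
    refine ⟨?_, ?_⟩
    · rw [key ha hb hc, key hb ha hc, h.potentiality z hz a b c ha.1 hb.1 hc.1]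
    · rw [key ha hb hc, key ha hc hb]
      -- the symmetry in the last two arguments is the commutativity of the multiplication
      have hcomm : (fun w => mul w (b w) (c w)) =ᶠ[nhds z] fun w => mul w (c w) (b w) := by
        filter_upwards [h.isOpen.mem_nhds hz] with w hw
        exact h.mul_comm w hw _ _
      rw [logNabla_congr Γ hcomm, h.mul_comm z hz _ (c z), h.mul_comm z hz (b z), sub_right_comm]
  case conn_flat =>
    rintro z ⟨hz, hD⟩ X Y Z hX hY hZ
    obtain ⟨a, ha⟩ := exists_isLogGerm hD hX
    obtain ⟨b, hb⟩ := exists_isLogGerm hD hY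
    obtain ⟨c, hc⟩ := exists_isLogGerm hD hZ
    have hΓ := h.conn_analytic z hz
    rw [(ha.covDeriv hΓ hD (hb.covDeriv hΓ hD hc)).eq, (hb.covDeriv hΓ hD (ha.covDeriv hΓ hD hc)).eq,
      ((ha.lieBracket hb).covDeriv hΓ hD hc).eq, ← map_sub, ← map_sub,
      h.conn_flat z hz a b c ha.1 hb.1 hc.1, map_zero]
  case unit_flat =>
    rintro z ⟨hz, hD⟩ X hX
    obtain ⟨a, ha⟩ := exists_isLogGerm hD hX
    rw [(ha.covDeriv (h.conn_analytic z hz) hD (isLogGerm_logField (h.e_analytic z hz))).eq,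
      h.unit_flat z hz a, map_zero]
  case lie_mul =>
    rintro z ⟨hz, hD⟩ X Y hX hY
    obtain ⟨a, ha⟩ := exists_isLogGerm hD hX
    obtain ⟨b, hb⟩ := exists_isLogGerm hD hY
    have hE : IsLogGerm r z (logField r E) E := isLogGerm_logField (h.E_analytic z hz)
    rw [(hE.lieBracket (ha.mul (h.mul_analytic z hz) hD hb)).eq, (hE.lieBracket ha).eq,
      (hE.lieBracket hb).eq, ha.eq, hb.eq, offDivisorMul_logFrame _ hD,
      offDivisorMul_logFrame _ hD, offDivisorMul_logFrame _ hD, ← map_sub, ← map_sub,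
      h.lie_mul z hz a b ha.1 hb.1]
  case lie_g =>
    rintro z ⟨hz, hD⟩ X Y hX hY
    obtain ⟨a, ha⟩ := exists_isLogGerm hD hX
    obtain ⟨b, hb⟩ := exists_isLogGerm hD hY
    have hE : IsLogGerm r z (logField r E) E := isLogGerm_logField (h.E_analytic z hz)
    rw [hE.fderiv_apply (ha.form g hD hb), (hE.lieBracket ha).eq,
      (hE.lieBracket hb).eq, ha.eq, hb.eq, offDivisorForm_logFrame _ hD,
      offDivisorForm_logFrame _ hD, offDivisorForm_logFrame _ hD, h.lie_g z hz a b ha.1 hb.1]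

end Transport

/-! ### The Frobenius structure induced by a primitive section -/

namespace LogFrobeniusTypeStructure

variable {m r : ℕ} {F : Type*} [NormedAddCommGroup F] [NormedSpace ℂ F] [FiniteDimensional ℂ F]

/-- The bundle map `v`, with values in the continuous linear maps. -/
noncomputable def vCLM (S : LogFrobeniusTypeStructure m r F) (ξ : CSpace m → F) (z : CSpace m) :
    CSpace m →L[ℂ] F :=
  -((S.higgs z).flip (ξ z))

theorem vCLM_apply (S : LogFrobeniusTypeStructure m r F) (ξ : CSpace m → F) (z x : CSpace m) :
    S.vCLM ξ z x = - S.higgs z x (ξ z) := rfl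

/-- Over the open set `U`, the section `ξ` is holomorphic, flat (across the divisor as well) and an
eigenvector of `𝒱`, and `Q` is a holomorphic inverse of the bundle map `v : X ↦ -C_X ξ`. -/
structure IsPrimitiveOn (S : LogFrobeniusTypeStructure m r F) (ξ : CSpace m → F) (d : ℂ)
    (U : Set (CSpace m)) (Q : CSpace m → F →L[ℂ] CSpace m) : Prop where
  isOpen : IsOpen U
  subset : U ⊆ S.dom
  analytic : AnalyticOnNhd ℂ ξ U
  flat : ∀ z ∈ U, ∀ a : CSpace m → CSpace m, logNabla r S.conn a ξ z = 0
  opV : ∀ z ∈ U, S.opV z (ξ z) = (d / 2) • ξ z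
  inv_analytic : AnalyticOnNhd ℂ Q U
  inv_vCLM : ∀ z ∈ U, ∀ x : CSpace m, Q z (S.vCLM ξ z x) = x
  vCLM_inv : ∀ z ∈ U, ∀ s : F, S.vCLM ξ z (Q z s) = s

/-- The multiplication `X ∘ Y = v⁻¹ (-C_X v(Y))`. -/
noncomputable def pullMul (S : LogFrobeniusTypeStructure m r F) (ξ : CSpace m → F)
    (Q : CSpace m → F →L[ℂ] CSpace m) (z : CSpace m) : CSpace m →L[ℂ] CSpace m →L[ℂ] CSpace m :=
  conjBilin (Q z) (-(S.higgs z)) (S.vCLM ξ z)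

/-- The unit field `e = v⁻¹ ξ`. -/
noncomputable def pullUnit (ξ : CSpace m → F) (Q : CSpace m → F →L[ℂ] CSpace m) (z : CSpace m) :
    CSpace m :=
  Q z (ξ z)

/-- The Euler field `E = v⁻¹ (𝒰 ξ)`. -/
noncomputable def pullEuler (S : LogFrobeniusTypeStructure m r F) (ξ : CSpace m → F)
    (Q : CSpace m → F →L[ℂ] CSpace m) (z : CSpace m) : CSpace m :=
  Q z (S.opU z (ξ z))

/-- The pairing `g(v(X), v(Y))`. -/
noncomputable def pullMetric (S : LogFrobeniusTypeStructure m r F) (ξ : CSpace m → F)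
    (z : CSpace m) : CSpace m →L[ℂ] CSpace m →L[ℂ] ℂ :=
  conjBilin (ContinuousLinearMap.id ℂ ℂ) ((S.metric z).comp (S.vCLM ξ z)) (S.vCLM ξ z)

/-- The logarithmic connection form of `v⁻¹ ∘ ∇^r ∘ v`. The second term comes from the derivative
of `v`. -/
noncomputable def pullConn (S : LogFrobeniusTypeStructure m r F) (ξ : CSpace m → F)
    (Q : CSpace m → F →L[ℂ] CSpace m) (z : CSpace m) : CSpace m →L[ℂ] CSpace m →L[ℂ] CSpace m :=
  conjBilin (Q z) (S.conn z) (S.vCLM ξ z) +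
    conjBilin (Q z) ((fderiv ℂ (S.vCLM ξ) z).comp (logFrame r z))
      (ContinuousLinearMap.id ℂ (CSpace m))

set_option maxSynthPendingDepth 3 in
theorem analyticAt_vCLM (S : LogFrobeniusTypeStructure m r F) {ξ : CSpace m → F} {z : CSpace m}
    (hz : z ∈ S.dom) (hξ : AnalyticAt ℂ ξ z) : AnalyticAt ℂ (S.vCLM ξ) z := by
  have hflip : AnalyticAt ℂ (fun w => (S.higgs w).flip) z :=
    (ContinuousLinearMap.flipₗᵢ ℂ (CSpace m) F F).toContinuousLinearEquiv.toContinuousLinearMap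
      |>.analyticAt _ |>.comp (S.higgs_analytic z hz)
  exact (analyticAt_clm_apply hflip hξ).neg

namespace IsPrimitiveOn

variable {S : LogFrobeniusTypeStructure m r F} {ξ : CSpace m → F} {d : ℂ} {U : Set (CSpace m)}
  {Q : CSpace m → F →L[ℂ] CSpace m} {z : CSpace m}

theorem analyticAt_v (h : S.IsPrimitiveOn ξ d U Q) (hz : z ∈ U) : AnalyticAt ℂ (S.vCLM ξ) z :=
  S.analyticAt_vCLM (h.subset hz) (h.analytic z hz)

theorem v_injective (h : S.IsPrimitiveOn ξ d U Q) (hz : z ∈ U) :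
    Function.Injective (S.vCLM ξ z) :=
  Function.LeftInverse.injective (h.inv_vCLM z hz)

theorem v_surjective (h : S.IsPrimitiveOn ξ d U Q) (hz : z ∈ U) :
    Function.Surjective (S.vCLM ξ z) :=
  Function.RightInverse.surjective (h.vCLM_inv z hz)

theorem analyticAt_mul (h : S.IsPrimitiveOn ξ d U Q) (hz : z ∈ U) :
    AnalyticAt ℂ (S.pullMul ξ Q) z :=
  analyticAt_conjBilin (h.inv_analytic z hz) (S.higgs_analytic z (h.subset hz)).neg
    (h.analyticAt_v hz)

theorem analyticAt_unit (h : S.IsPrimitiveOn ξ d U Q) (hz : z ∈ U) :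
    AnalyticAt ℂ (pullUnit ξ Q) z :=
  analyticAt_clm_apply (h.inv_analytic z hz) (h.analytic z hz)

theorem analyticAt_euler (h : S.IsPrimitiveOn ξ d U Q) (hz : z ∈ U) :
    AnalyticAt ℂ (S.pullEuler ξ Q) z :=
  analyticAt_clm_apply (h.inv_analytic z hz)
    (analyticAt_clm_apply (S.opU_analytic z (h.subset hz)) (h.analytic z hz))

theorem analyticAt_metric (h : S.IsPrimitiveOn ξ d U Q) (hz : z ∈ U) :
    AnalyticAt ℂ (S.pullMetric ξ) z :=
  analyticAt_conjBilin analyticAt_const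
    (analyticAt_clm_comp (S.metric_analytic z (h.subset hz)) (h.analyticAt_v hz))
    (h.analyticAt_v hz)

theorem analyticAt_conn (h : S.IsPrimitiveOn ξ d U Q) (hz : z ∈ U) :
    AnalyticAt ℂ (S.pullConn ξ Q) z := by
  have : CompleteSpace F := FiniteDimensional.complete ℂ F
  exact (analyticAt_conjBilin (h.inv_analytic z hz) (S.conn_analytic z (h.subset hz))
      (h.analyticAt_v hz)).add
    (analyticAt_conjBilin (h.inv_analytic z hz)
      (analyticAt_clm_comp (h.analyticAt_v hz).fderiv (analyticAt_logFrame r z)) analyticAt_const)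

theorem v_mul (h : S.IsPrimitiveOn ξ d U Q) (hz : z ∈ U) (x y : CSpace m) :
    S.vCLM ξ z (S.pullMul ξ Q z x y) = - S.higgs z x (S.vCLM ξ z y) :=
  h.vCLM_inv z hz _

theorem v_unit (h : S.IsPrimitiveOn ξ d U Q) (hz : z ∈ U) :
    S.vCLM ξ z (pullUnit ξ Q z) = ξ z :=
  h.vCLM_inv z hz _

theorem v_euler (h : S.IsPrimitiveOn ξ d U Q) (hz : z ∈ U) :
    S.vCLM ξ z (S.pullEuler ξ Q z) = S.opU z (ξ z) :=
  h.vCLM_inv z hz _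

theorem metric_apply (S : LogFrobeniusTypeStructure m r F) (ξ : CSpace m → F) (z x y : CSpace m) :
    S.pullMetric ξ z x y = S.metric z (S.vCLM ξ z x) (S.vCLM ξ z y) := rfl

theorem v_nabla (h : S.IsPrimitiveOn ξ d U Q) (hz : z ∈ U) (a : CSpace m → CSpace m)
    {b : CSpace m → CSpace m} (hb : AnalyticAt ℂ b z) :
    S.vCLM ξ z (logNabla r (S.pullConn ξ Q) a b z) =
      logNabla r S.conn a (fun w => S.vCLM ξ w (b w)) z := by
  have hd : fderiv ℂ (fun w => S.vCLM ξ w (b w)) z = _ :=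
    ((h.analyticAt_v hz).differentiableAt.hasFDerivAt.clm_apply
      hb.differentiableAt.hasFDerivAt).fderiv
  simp only [logNabla, logDirDeriv, hd]
  simp only [pullConn, map_add, add_apply, conjBilin_apply, h.vCLM_inv z hz, logField,
    ContinuousLinearMap.comp_apply, ContinuousLinearMap.flip_apply, ContinuousLinearMap.id_apply]
  abel

theorem mul_comm (h : S.IsPrimitiveOn ξ d U Q) (hz : z ∈ U) (x y : CSpace m) :
    S.pullMul ξ Q z x y = S.pullMul ξ Q z y x := by
  apply h.v_injective hz
  rw [h.v_mul hz, h.v_mul hz, vCLM_apply, vCLM_apply, map_neg, map_neg,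
    S.higgs_comm z (h.subset hz)]

/-- A Higgs field with a generating section is a representation of the multiplication, up to
sign: `C_{X ∘ Y} = - C_X C_Y`. -/
theorem higgs_mul (h : S.IsPrimitiveOn ξ d U Q) (hz : z ∈ U) (x y : CSpace m) (s : F) :
    S.higgs z (S.pullMul ξ Q z x y) s = - S.higgs z x (S.higgs z y s) := by
  obtain ⟨w, rfl⟩ := h.v_surjective hz s
  have hc := S.higgs_comm z (h.subset hz)
  have hxy := h.v_mul hz x y
  simp only [vCLM_apply, map_neg, neg_neg] at hxy ⊢
  rw [hc, hc y w, hc x w, ← hxy, map_neg]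

/-- `C_E = - 𝒰`. -/
theorem higgs_euler (h : S.IsPrimitiveOn ξ d U Q) (hz : z ∈ U) (s : F) :
    S.higgs z (S.pullEuler ξ Q z) s = - S.opU z s := by
  obtain ⟨w, rfl⟩ := h.v_surjective hz s
  have hE := h.v_euler hz
  simp only [vCLM_apply, map_neg, neg_neg] at hE ⊢
  rw [S.higgs_comm z (h.subset hz), S.opU_higgs z (h.subset hz), ← hE, map_neg]

theorem v_euler_mul (h : S.IsPrimitiveOn ξ d U Q) (hz : z ∈ U) (x : CSpace m) :
    S.vCLM ξ z (S.pullMul ξ Q z (S.pullEuler ξ Q z) x) = S.opU z (S.vCLM ξ z x) := by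
  rw [h.v_mul hz, h.higgs_euler hz, neg_neg]

/-- The derivative of the Euler field corresponds to `𝒱 + (2 - d)/2`. This is the equation for
`∇^r 𝒰` evaluated on the flat eigenvector `ξ` of `𝒱`. -/
theorem v_nabla_euler (h : S.IsPrimitiveOn ξ d U Q) (hz : z ∈ U) {a : CSpace m → CSpace m}
    (ha : AnalyticAt ℂ a z) :
    S.vCLM ξ z (logNabla r (S.pullConn ξ Q) a (S.pullEuler ξ Q) z) =
      S.opV z (S.vCLM ξ z (a z)) + ((2 - d) / 2) • S.vCLM ξ z (a z) := by
  have hE : (fun w => S.vCLM ξ w (S.pullEuler ξ Q w)) =ᶠ[nhds z] fun w => S.opU w (ξ w) := by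
    filter_upwards [h.isOpen.mem_nhds hz] with w hw
    exact h.v_euler hw
  have hU := S.opU_eq z (h.subset hz) a ξ ha (h.analytic z hz)
  rw [h.flat z hz a, map_zero, sub_zero, h.opV z hz, map_smul] at hU
  rw [h.v_nabla hz a (h.analyticAt_euler hz), logNabla_congr _ hE, vCLM_apply, map_neg]
  linear_combination (norm := module) hU

theorem torsionFree (h : S.IsPrimitiveOn ξ d U Q) (hz : z ∈ U) {a b : CSpace m → CSpace m}
    (ha : AnalyticAt ℂ a z) (hb : AnalyticAt ℂ b z) :
    logNabla r (S.pullConn ξ Q) a b z - logNabla r (S.pullConn ξ Q) b a z =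
      logBracket r a b z := by
  apply h.v_injective hz
  have hp := S.higgs_potential z (h.subset hz) a b ξ ha hb (h.analytic z hz)
  rw [h.flat z hz, h.flat z hz, map_zero, map_zero, sub_zero, sub_zero] at hp
  rw [map_sub, h.v_nabla hz a hb, h.v_nabla hz b ha]
  simp only [vCLM_apply, logNabla_neg]
  linear_combination (norm := module) -hp

theorem v_nabla_mul (h : S.IsPrimitiveOn ξ d U Q) (hz : z ∈ U) (a : CSpace m → CSpace m)
    {b c : CSpace m → CSpace m} (hb : AnalyticAt ℂ b z) (hc : AnalyticAt ℂ c z) :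
    S.vCLM ξ z (logNabla r (S.pullConn ξ Q) a (fun w => S.pullMul ξ Q w (b w) (c w)) z) =
      - logNabla r S.conn a (fun w => S.higgs w (b w) (S.vCLM ξ w (c w))) z := by
  have hE : (fun w => S.vCLM ξ w (S.pullMul ξ Q w (b w) (c w))) =ᶠ[nhds z]
      fun w => - S.higgs w (b w) (S.vCLM ξ w (c w)) := by
    filter_upwards [h.isOpen.mem_nhds hz] with w hw
    exact h.v_mul hw _ _
  rw [h.v_nabla hz a (analyticAt_clm_apply (analyticAt_clm_apply (h.analyticAt_mul hz) hb) hc),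
    logNabla_congr _ hE, logNabla_neg]

theorem potentiality (h : S.IsPrimitiveOn ξ d U Q) (hz : z ∈ U) {a b c : CSpace m → CSpace m}
    (ha : AnalyticAt ℂ a z) (hb : AnalyticAt ℂ b z) (hc : AnalyticAt ℂ c z) :
    logNabla r (S.pullConn ξ Q) a (fun w => S.pullMul ξ Q w (b w) (c w)) z
        - S.pullMul ξ Q z (logNabla r (S.pullConn ξ Q) a b z) (c z)
        - S.pullMul ξ Q z (b z) (logNabla r (S.pullConn ξ Q) a c z) =
      logNabla r (S.pullConn ξ Q) b (fun w => S.pullMul ξ Q w (a w) (c w)) z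
        - S.pullMul ξ Q z (logNabla r (S.pullConn ξ Q) b a z) (c z)
        - S.pullMul ξ Q z (a z) (logNabla r (S.pullConn ξ Q) b c z) := by
  apply h.v_injective hz
  have hp := S.higgs_potential z (h.subset hz) a b (fun w => S.vCLM ξ w (c w)) ha hb
    (analyticAt_clm_apply (h.analyticAt_v hz) hc)
  rw [← h.torsionFree hz ha hb, map_sub, sub_apply] at hp
  simp only [map_sub, h.v_nabla_mul hz _ hb hc, h.v_nabla_mul hz _ ha hc, h.v_mul hz,
    h.v_nabla hz _ hc]
  linear_combination (norm := module) -hp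

/-- `Lie_E(∘) = ∘`. Torsion-freeness turns Lie brackets into covariant derivatives, potentiality
exchanges `∇_E ∘` for `∇_X (E ∘)`, and the latter is known through `∇^r 𝒰`. -/
theorem lie_mul (h : S.IsPrimitiveOn ξ d U Q) (hz : z ∈ U) {a b : CSpace m → CSpace m}
    (ha : AnalyticAt ℂ a z) (hb : AnalyticAt ℂ b z) :
    logBracket r (S.pullEuler ξ Q) (fun w => S.pullMul ξ Q w (a w) (b w)) z
        - S.pullMul ξ Q z (logBracket r (S.pullEuler ξ Q) a z) (b z)
        - S.pullMul ξ Q z (a z) (logBracket r (S.pullEuler ξ Q) b z) =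
      S.pullMul ξ Q z (a z) (b z) := by
  have hE := h.analyticAt_euler hz
  have hab : AnalyticAt ℂ (fun w => S.pullMul ξ Q w (a w) (b w)) z :=
    analyticAt_clm_apply (analyticAt_clm_apply (h.analyticAt_mul hz) ha) hb
  have hvb := analyticAt_clm_apply (h.analyticAt_v hz) hb
  have hU := S.opU_eq z (h.subset hz) a _ ha hvb
  have hEb : (fun w => S.higgs w (S.pullEuler ξ Q w) (S.vCLM ξ w (b w))) =ᶠ[nhds z]
      fun w => - S.opU w (S.vCLM ξ w (b w)) := by
    filter_upwards [h.isOpen.mem_nhds hz] with w hw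
    exact h.higgs_euler hw _
  have hp := congrArg (S.vCLM ξ z) (h.potentiality hz hE ha hb)
  rw [← h.torsionFree hz hE hab, ← h.torsionFree hz hE ha, ← h.torsionFree hz hE hb]
  apply h.v_injective hz
  simp only [map_sub, sub_apply, h.v_nabla_mul hz _ ha hb, h.v_nabla_mul hz _ hE hb, h.v_mul hz,
    h.v_nabla hz _ hb, h.v_nabla_euler hz hab, h.v_nabla_euler hz hb,
    logNabla_congr _ hEb, logNabla_neg, h.higgs_euler hz, map_add, map_smul, map_neg] at hp ⊢
  linear_combination (norm := module) hp + hU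

theorem conn_metric (h : S.IsPrimitiveOn ξ d U Q) (hz : z ∈ U) {a b c : CSpace m → CSpace m}
    (ha : AnalyticAt ℂ a z) (hb : AnalyticAt ℂ b z) (hc : AnalyticAt ℂ c z) :
    logDirDeriv r a (fun w => S.pullMetric ξ w (b w) (c w)) z =
      S.pullMetric ξ z (logNabla r (S.pullConn ξ Q) a b z) (c z)
        + S.pullMetric ξ z (b z) (logNabla r (S.pullConn ξ Q) a c z) := by
  simp only [metric_apply, h.v_nabla hz _ hb, h.v_nabla hz _ hc]
  exact S.metric_flat z (h.subset hz) a _ _ ha (analyticAt_clm_apply (h.analyticAt_v hz) hb)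
    (analyticAt_clm_apply (h.analyticAt_v hz) hc)

theorem lie_g (h : S.IsPrimitiveOn ξ d U Q) (hz : z ∈ U) {a b : CSpace m → CSpace m}
    (ha : AnalyticAt ℂ a z) (hb : AnalyticAt ℂ b z) :
    logDirDeriv r (S.pullEuler ξ Q) (fun w => S.pullMetric ξ w (a w) (b w)) z
        - S.pullMetric ξ z (logBracket r (S.pullEuler ξ Q) a z) (b z)
        - S.pullMetric ξ z (a z) (logBracket r (S.pullEuler ξ Q) b z) =
      (2 - d) * S.pullMetric ξ z (a z) (b z) := by
  have hE := h.analyticAt_euler hz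
  have hV := S.metric_opV z (h.subset hz) (S.vCLM ξ z (a z)) (S.vCLM ξ z (b z))
  rw [h.conn_metric hz hE ha hb, ← h.torsionFree hz hE ha, ← h.torsionFree hz hE hb]
  simp only [metric_apply, map_sub, sub_apply, add_apply, smul_apply, map_add, map_smul,
    smul_eq_mul, h.v_nabla_euler hz ha, h.v_nabla_euler hz hb]
  linear_combination hV

theorem conn_flat (h : S.IsPrimitiveOn ξ d U Q) (hz : z ∈ U) {a b c : CSpace m → CSpace m}
    (ha : AnalyticAt ℂ a z) (hb : AnalyticAt ℂ b z) (hc : AnalyticAt ℂ c z) :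
    logNabla r (S.pullConn ξ Q) a (logNabla r (S.pullConn ξ Q) b c) z
        - logNabla r (S.pullConn ξ Q) b (logNabla r (S.pullConn ξ Q) a c) z
        - logNabla r (S.pullConn ξ Q) (logBracket r a b) c z = 0 := by
  have key : ∀ {b : CSpace m → CSpace m},
      (fun w => S.vCLM ξ w (logNabla r (S.pullConn ξ Q) b c w)) =ᶠ[nhds z]
        logNabla r S.conn b (fun w => S.vCLM ξ w (c w)) := by
    intro b
    filter_upwards [h.isOpen.mem_nhds hz, hc.eventually_analyticAt] with w hw hcw
    exact h.v_nabla hw b hcw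
  apply h.v_injective hz
  rw [map_sub, map_sub, h.v_nabla hz a (analyticAt_logNabla (h.analyticAt_conn hz) hb hc),
    h.v_nabla hz b (analyticAt_logNabla (h.analyticAt_conn hz) ha hc), h.v_nabla hz _ hc,
    logNabla_congr _ key, logNabla_congr _ key, map_zero]
  exact S.conn_flat z (h.subset hz) a b _ ha hb (analyticAt_clm_apply (h.analyticAt_v hz) hc)

theorem unit_flat (h : S.IsPrimitiveOn ξ d U Q) (hz : z ∈ U) (a : CSpace m → CSpace m) :
    logNabla r (S.pullConn ξ Q) a (pullUnit ξ Q) z = 0 := by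
  have he : (fun w => S.vCLM ξ w (pullUnit ξ Q w)) =ᶠ[nhds z] ξ := by
    filter_upwards [h.isOpen.mem_nhds hz] with w hw
    exact h.v_unit hw
  apply h.v_injective hz
  rw [h.v_nabla hz a (h.analyticAt_unit hz), logNabla_congr _ he, h.flat z hz, map_zero]

theorem metric_nondeg (h : S.IsPrimitiveOn ξ d U Q) (hz : z ∈ U) {x : CSpace m}
    (hx : ∀ y, S.pullMetric ξ z x y = 0) : x = 0 := by
  apply h.v_injective hz
  rw [map_zero]
  refine S.metric_nondeg z (h.subset hz) _ fun t => ?_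
  obtain ⟨y, rfl⟩ := h.v_surjective hz t
  exact hx y

theorem isLogFrobenius (h : S.IsPrimitiveOn ξ d U Q) :
    IsLogFrobenius r U (S.pullMul ξ Q) (pullUnit ξ Q) (S.pullEuler ξ Q) (S.pullMetric ξ)
      (S.pullConn ξ Q) d where
  isOpen := h.isOpen
  mul_analytic _ hz := h.analyticAt_mul hz
  e_analytic _ hz := h.analyticAt_unit hz
  E_analytic _ hz := h.analyticAt_euler hz
  g_analytic _ hz := h.analyticAt_metric hz
  conn_analytic _ hz := h.analyticAt_conn hz
  mul_comm _ hz := h.mul_comm hz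
  mul_assoc z hz x y w := by
    apply h.v_injective hz
    rw [h.v_mul hz, h.v_mul hz, h.v_mul hz, h.higgs_mul hz, map_neg]
  unit_mul z hz x := by
    apply h.v_injective hz
    rw [h.v_mul hz, vCLM_apply, map_neg, neg_neg, S.higgs_comm z (h.subset hz), ← map_neg]
    exact congrArg (S.higgs z x) (neg_eq_iff_eq_neg.1 (h.v_unit hz))
  g_symm z hz x y := S.metric_symm z (h.subset hz) _ _
  g_nondeg _ hz _ hx := h.metric_nondeg hz hx
  torsionFree _ hz _ _ ha hb := h.torsionFree hz ha hb
  conn_metric _ hz _ _ _ ha hb hc := h.conn_metric hz ha hb hc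
  g_invariant z hz x y w := by
    rw [h.mul_comm hz x y, metric_apply, metric_apply, h.v_mul hz, h.v_mul hz, map_neg, map_neg,
      neg_apply, S.metric_higgs z (h.subset hz)]
  potentiality _ hz _ _ _ ha hb hc := h.potentiality hz ha hb hc
  conn_flat _ hz _ _ _ ha hb hc := h.conn_flat hz ha hb hc
  unit_flat _ hz a := h.unit_flat hz a
  lie_mul _ hz _ _ ha hb := h.lie_mul hz ha hb
  lie_g _ hz _ _ ha hb := h.lie_g hz ha hb

end IsPrimitiveOn

end LogFrobeniusTypeStructure

/-! ### Existence of the inverse bundle map near the base point -/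

namespace LogFrobeniusTypeStructure

variable {m r : ℕ} {F : Type*} [NormedAddCommGroup F] [NormedSpace ℂ F] [FiniteDimensional ℂ F]

/-- A section that is flat off the divisor is flat across it, since the complement of the divisor
is dense. -/
theorem flat_of_flat_off_divisor (S : LogFrobeniusTypeStructure m r F) {ξ : CSpace m → F}
    (hξ : AnalyticOnNhd ℂ ξ S.dom)
    (hflat : ∀ z ∈ S.dom \ ncDivisor m r, ∀ a : CSpace m → CSpace m, AnalyticAt ℂ a z →
      logNabla r S.conn a ξ z = 0)
    {z : CSpace m} (hz : z ∈ S.dom) (a : CSpace m → CSpace m) : logNabla r S.conn a ξ z = 0 := by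
  have : CompleteSpace F := FiniteDimensional.complete ℂ F
  rw [logNabla_congr_left (b := fun _ => a z) S.conn rfl]
  by_contra hne
  have hcont : ContinuousAt (logNabla r S.conn (fun _ => a z) ξ) z :=
    (analyticAt_logNabla (S.conn_analytic z hz) analyticAt_const (hξ z hz)).continuousAt
  obtain ⟨w, hwD, hw, hwne⟩ := (dense_compl_ncDivisor m r).inter_nhds_nonempty
    (Filter.inter_mem (S.isOpen_dom.mem_nhds hz) (hcont.eventually_ne hne))
  exact hwne (hflat w ⟨hw, hwD⟩ _ analyticAt_const)

theorem exists_isPrimitiveOn (S : LogFrobeniusTypeStructure m r F) (ξ : CSpace m → F) (d : ℂ)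
    (hξ : AnalyticOnNhd ℂ ξ S.dom)
    (hflat : ∀ z ∈ S.dom \ ncDivisor m r, ∀ a : CSpace m → CSpace m, AnalyticAt ℂ a z →
      logNabla r S.conn a ξ z = 0)
    (hiso : Function.Bijective fun a : CSpace m => - S.higgs 0 a (ξ 0))
    (hV : ∀ z ∈ S.dom, S.opV z (ξ z) = (d / 2) • ξ z) :
    ∃ U Q, (0 : CSpace m) ∈ U ∧ S.IsPrimitiveOn ξ d U Q := by
  let φ : CSpace m ≃L[ℂ] F :=
    (LinearEquiv.ofBijective (S.vCLM ξ 0 : CSpace m →ₗ[ℂ] F) hiso).toContinuousLinearEquiv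
  have hφ : ∀ x, φ x = S.vCLM ξ 0 x := fun _ => rfl
  -- comparing `v` with its value at `0` turns invertibility into being a unit of a Banach algebra
  let T : CSpace m → (CSpace m →L[ℂ] CSpace m) := fun z =>
    (φ.symm : F →L[ℂ] CSpace m).comp (S.vCLM ξ z)
  have hT : AnalyticOnNhd ℂ T S.dom := fun z hz =>
    analyticAt_clm_comp analyticAt_const (S.analyticAt_vCLM hz (hξ z hz))
  have hT0 : T 0 = 1 := by
    ext1 x
    exact φ.symm_apply_apply x
  refine ⟨S.dom ∩ T ⁻¹' {u | IsUnit u},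
    fun z => (Ring.inverse (T z)).comp (φ.symm : F →L[ℂ] CSpace m),
    ⟨S.zero_mem, by simp [hT0]⟩, ?_⟩
  constructor
  case isOpen => exact hT.continuousOn.isOpen_inter_preimage S.isOpen_dom Units.isOpen
  case subset => exact Set.inter_subset_left
  case analytic => exact fun z hz => hξ z hz.1
  case flat => exact fun z hz a => S.flat_of_flat_off_divisor hξ hflat hz.1 a
  case opV => exact fun z hz => hV z hz.1
  case inv_analytic =>
    rintro z ⟨hz, u, hu⟩
    refine analyticAt_clm_comp ?_ analyticAt_const
    exact (hu ▸ analyticAt_inverse (𝕜 := ℂ) u : AnalyticAt ℂ Ring.inverse (T z)).comp (hT z hz)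
  case inv_vCLM =>
    rintro z ⟨_, hu⟩ x
    exact DFunLike.congr_fun (Ring.inverse_mul_cancel (T z) hu) x
  case vCLM_inv =>
    rintro z ⟨_, hu⟩ s
    exact φ.symm.injective (DFunLike.congr_fun (Ring.mul_inverse_cancel (T z) hu) (φ.symm s))

end LogFrobeniusTypeStructure

/-! ### The Frobenius manifold with logarithmic poles -/

theorem proposition1 {m r : ℕ} {F : Type*} [NormedAddCommGroup F] [NormedSpace ℂ F]
    [FiniteDimensional ℂ F] (S : LogFrobeniusTypeStructure m r F) (ξ : CSpace m → F) (d : ℂ)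
    (hξ : AnalyticOnNhd ℂ ξ S.dom)
    (hξ_flat : ∀ z ∈ S.dom \ ncDivisor m r, ∀ a : CSpace m → CSpace m, AnalyticAt ℂ a z →
      logNabla r S.conn a ξ z = 0)
    (hiso : Function.Bijective fun a : CSpace m => - S.higgs 0 a (ξ 0))
    (hV : ∀ z ∈ S.dom, S.opV z (ξ z) = (d / 2) • ξ z) :
    ∃ M : LogFrobeniusManifold m r, M.d = d ∧ S.CorrespondsTo ξ M := by
  obtain ⟨U, Q, h0, h⟩ := S.exists_isPrimitiveOn ξ d hξ hξ_flat hiso hV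
  refine ⟨{
    dom := U
    isOpen_dom := h.isOpen
    zero_mem := h0
    r_pos := S.r_pos
    r_le := S.r_le
    mul := offDivisorMul r (S.pullMul ξ Q)
    e := logField r (LogFrobeniusTypeStructure.pullUnit ξ Q)
    E := logField r (S.pullEuler ξ Q)
    g := offDivisorForm r (S.pullMetric ξ)
    conn := offDivisorConn r (S.pullConn ξ Q)
    d := d
    frobenius := h.isLogFrobenius.isFrobeniusManifold (S.r_pos.trans_le S.r_le)
    mulLog := S.pullMul ξ Q
    eLog := LogFrobeniusTypeStructure.pullUnit ξ Q
    ELog := S.pullEuler ξ Q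
    gLog := S.pullMetric ξ
    connLog := S.pullConn ξ Q
    mulLog_analytic := fun _ hz => h.analyticAt_mul hz
    eLog_analytic := fun _ hz => h.analyticAt_unit hz
    ELog_analytic := fun _ hz => h.analyticAt_euler hz
    gLog_analytic := fun _ hz => h.analyticAt_metric hz
    connLog_analytic := fun _ hz => h.analyticAt_conn hz
    mul_eq := fun _ hz => offDivisorMul_logFrame _ hz.2
    e_eq := fun _ _ => rfl
    E_eq := fun _ _ => rfl
    g_eq := fun _ hz => offDivisorForm_logFrame _ hz.2
    conn_eq := fun _ hz a _ _ hb => covDeriv_logField _ hz.2 a hb.differentiableAt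
    gLog_nondeg := fun _ hz _ => h.metric_nondeg hz }, rfl, ?_⟩
  constructor
  case dom_subset => exact h.subset
  case bijective => exact fun z hz => ⟨h.v_injective hz, h.v_surjective hz⟩
  case unit => exact fun z hz => h.v_unit hz
  case euler => exact fun z hz => h.v_euler hz
  case nabla => exact fun z hz a b _ hb => h.v_nabla hz a hb
  case mul => exact fun z hz => h.v_mul hz
  case metric => exact fun _ _ _ _ => rfl
  case opU => exact fun z hz => h.v_euler_mul hz
  case opV =>
    intro z hz x
    change S.vCLM ξ z (_ - _) = S.opV z (S.vCLM ξ z x)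
    rw [map_sub, h.v_nabla_euler hz analyticAt_const, map_smul, add_sub_cancel_right]
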